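/- Let $T$ be a compact metrizable space with its Borel $\sigma$-algebra (for instance a finite tree, nodes and all points of the edges, with its tree metric). Let $\mu,\nu$ be finite nonnegative Borel measures on $T$, let $b\ge 0$, let $c:T\times T\to\mathbb R$ be continuous with $c(x,x)=0$ for all $x$, let $w_1,w_2:T\to[0,\infty)$ be Borel measurable, and let $\lambda\ge 0$. Let $\Pi_{\le}(\mu,\nu)$ be the set of finite nonnegative Borel measures $\gamma$ on $T\times T$ whose marginals satisfy $\gamma_1\le\mu$ and $\gamma_2\le\nu$; write $\gamma_1=f_1\mu$ and $\gamma_2=f_2\nu$, and put $$\mathrm{ET}_{c,\lambda}(\mu,\nu)=\inf_{\gamma\in\Pi_{\le}(\mu,\nu)}\Big[\int_T w_1(1-f_1)\,d\mu+\int_T w_2(1-f_2)\,d\nu+b\int_{T\times T}[c(x,y)-\lambda]\,\gamma(dx,dy)\Big],$$ an extended real number. Let $\mathbb K$ be the set of pairs $(u,v)$ of functions $u,v:T\to\mathbb R$ with $u\in L^1(\mu)$, $v\in L^1(\nu)$ such that for all $x,y\in T$ $$u(x)\le w_1(x),\qquad -b\lambda+\inf_{z\in T}\,[\,b\,c(z,y)-w_1(z)\,]\le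 v(y)\le w_2(y),\qquad u(x)+v(y)\le b\,[c(x,y)-\lambda],$$ where the infimum may be $-\infty$. Then $$\mathrm{ET}_{c,\lambda}(\mu,\nu)=\sup_{(u,v)\in\mathbb K}\Big[\int_T u\,d\mu+\int_T v\,d\nu\Big],$$ as an equality of extended real numbers. -/

import Mathlib

open MeasureTheory

noncomputable section

/-- `Π_≤(μ, ν)`: the finite nonnegative Borel measures on `T × T` whose first marginal is dominated
by `μ` and whose second marginal is dominated by `ν`. -/
def subcouplings {T : Type*} [MeasurableSpace T] (μ ν : Measure T) : Set (Measure (T × T)) :=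
  {γ | IsFiniteMeasure γ ∧ γ.fst ≤ μ ∧ γ.snd ≤ ν}

/-- The functional `∫ w₁ (1 - f₁) dμ + ∫ w₂ (1 - f₂) dν + b ∫ (c - lam) dγ`, where `f₁` and `f₂` are
the Radon-Nikodym derivatives of the marginals of `γ` with respect to `μ` and `ν`. On `Π_≤(μ, ν)`
one has `0 ≤ f₁ ≤ 1` and `0 ≤ f₂ ≤ 1` almost everywhere, so for nonnegative weights the first two
integrals have nonnegative integrands and always make sense in `[0, ∞]`. -/
def eptCost {T : Type*} [MeasurableSpace T] (b : ℝ) (c : T → T → ℝ) (lam : ℝ) (w₁ w₂ : T → ℝ)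
    (μ ν : Measure T) (γ : Measure (T × T)) : EReal :=
  ((∫⁻ x, ENNReal.ofReal (w₁ x * (1 - (γ.fst.rnDeriv μ x).toReal)) ∂μ : ENNReal) : EReal)
    + ((∫⁻ y, ENNReal.ofReal (w₂ y * (1 - (γ.snd.rnDeriv ν y).toReal)) ∂ν : ENNReal) : EReal)
    + ((b * ∫ p, (c p.1 p.2 - lam) ∂γ : ℝ) : EReal)

/-- The entropy partial transport value `ET_{c,lam}(μ, ν)`, for the entropies `F₁(s) = F₂(s) = |s - 1|`. -/
def ET {T : Type*} [MeasurableSpace T] (b : ℝ) (c : T → T → ℝ) (lam : ℝ) (w₁ w₂ : T → ℝ)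
    (μ ν : Measure T) : EReal :=
  ⨅ γ ∈ subcouplings μ ν, eptCost b c lam w₁ w₂ μ ν γ

/-- The class `𝕂` of pairs `(u, v)` of real functions, `u ∈ L¹(μ)` and `v ∈ L¹(ν)`, that satisfy the
three constraints at every point. The infimum is taken in the extended reals: it is `-∞`, and the
lower bound on `v` is void, where `x ↦ b c(x, y) - w₁(x)` is unbounded below. -/
def dualClass {T : Type*} [MeasurableSpace T] (b : ℝ) (c : T → T → ℝ) (lam : ℝ) (w₁ w₂ : T → ℝ)
    (μ ν : Measure T) : Set ((T → ℝ) × (T → ℝ)) :=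
  {p | Integrable p.1 μ ∧ Integrable p.2 ν ∧
    (∀ x, p.1 x ≤ w₁ x) ∧
    (∀ y, ((-(b * lam) : ℝ) : EReal) + (⨅ x, ((b * c x y - w₁ x : ℝ) : EReal)) ≤ (p.2 y : EReal)) ∧
    (∀ y, p.2 y ≤ w₂ y) ∧
    (∀ x y, p.1 x + p.2 y ≤ b * (c x y - lam))}

end

/-!
Weak duality integrates the pointwise constraints against a subcoupling. For the converse, let `D` be
a real upper bound of the dual problem. The sublinear functional `marginalCost μ ν`, defined on all
bounded functions on `T × T`, encodes the marginal constraints: by Riesz-Markov-Kakutani and density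
of continuous functions in `L¹`, every linear functional below it is integration against a subcoupling
(`exists_subcoupling_of_le_marginalCost`). It also encodes the dual problem: a pair dominating
`w₁ + w₂ - b (c - lam)` is, after subtraction from `(w₁, w₂)`, a feasible dual pair, up to the lower
bound on `v`, which can always be restored (`exists_mem_dualClass_of_feasible`). So Hahn-Banach yields
a functional that attains `marginalCost` at `w₁ + w₂ - b (c - lam)`, and its measure has cost at most
`D`; no minimax theorem is needed.

The weights may be unbounded, even non-integrable, so this is done for `min w₁ n` and `min w₂ n`. One
functional serves all `n` by compactness (`exists_linearMap_le_sublinear_of_seq`), since truncated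
costs increase with `n`. Monotone convergence then bounds the cost for `w₁` and `w₂`.
-/

open Filter Topology
open scoped CompactlySupported

/-! ### Functionals below a sublinear function -/

theorem exists_linearMap_le_sublinear_apply_eq {E : Type*} [AddCommGroup E] [Module ℝ E]
    (N : E → ℝ) (N_hom : ∀ t : ℝ, 0 < t → ∀ x, N (t • x) = t * N x)
    (N_add : ∀ x y, N (x + y) ≤ N x + N y) (x₀ : E) :
    ∃ L : E →ₗ[ℝ] ℝ, (∀ x, L x ≤ N x) ∧ L x₀ = N x₀ := by
  have N_0 : N 0 = 0 := by
    have := N_hom 2 (by norm_num) 0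
    rw [smul_zero] at this
    linarith
  have H : ∀ t : ℝ, t • x₀ = 0 → (RingHom.id ℝ) t • N x₀ = 0 := by
    intro t ht
    rcases smul_eq_zero.1 ht with h | h
    · simp [h]
    · simp [h, N_0]
  obtain ⟨g, hg, hgN⟩ := exists_extension_of_le_sublinear
    (LinearPMap.mkSpanSingleton' x₀ (N x₀) H) N N_hom N_add (by
      rintro ⟨x, hx⟩
      obtain ⟨t, rfl⟩ := Submodule.mem_span_singleton.1 hx
      rw [LinearPMap.mkSpanSingleton'_apply]
      simp only [RingHom.id_apply, smul_eq_mul]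
      rcases lt_trichotomy t 0 with ht | rfl | ht
      · have h1 := N_add (t • x₀) ((-t) • x₀)
        rw [← add_smul, add_neg_cancel, zero_smul, N_0, N_hom (-t) (by linarith)] at h1
        linarith
      · simp [N_0]
      · rw [N_hom t ht])
  refine ⟨g, hgN, ?_⟩
  exact (hg ⟨x₀, Submodule.mem_span_singleton_self x₀⟩).trans
    (LinearPMap.mkSpanSingleton'_apply_self x₀ (N x₀) H _)

/-- Hahn-Banach with countably many lower bounds: if the increments of `h` cost at most those of `a`,
then a functional dominated by `N` that meets the `n`-th bound meets all earlier ones. The functionals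
meeting the first `n` bounds thus form a decreasing sequence of nonempty closed sets, compact by
Tychonoff, since `-N (-x) ≤ L x ≤ N x`. -/
theorem exists_linearMap_le_sublinear_of_seq {E : Type*} [AddCommGroup E] [Module ℝ E]
    (N : E → ℝ) (N_hom : ∀ t : ℝ, 0 < t → ∀ x, N (t • x) = t * N x)
    (N_add : ∀ x y, N (x + y) ≤ N x + N y) (h : ℕ → E) (a : ℕ → ℝ)
    (h_le : ∀ n, a n ≤ N (h n)) (h_sub : ∀ n, N (h (n + 1) - h n) ≤ a (n + 1) - a n) :
    ∃ L : E →ₗ[ℝ] ℝ, (∀ x, L x ≤ N x) ∧ ∀ n, a n ≤ L (h n) := by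
  let K : ℕ → Set (E → ℝ) := fun n =>
    {φ | (∃ L : E →ₗ[ℝ] ℝ, ⇑L = φ) ∧ (∀ x, φ x ≤ N x) ∧ a n ≤ φ (h n)}
  have hclosed : ∀ n, IsClosed (K n) := by
    intro n
    refine IsClosed.inter (LinearMap.isClosed_range_coe E ℝ (RingHom.id ℝ)) 
      (IsClosed.inter (isClosed_Iic (a := N)) ?_)
    exact isClosed_le continuous_const (continuous_apply (h n))
  have hcompact : IsCompact (K 0) := by
    refine (isCompact_univ_pi fun x : E => isCompact_Icc (a := -N (-x)) (b := N x)).of_isClosed_subset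
      (hclosed 0) ?_
    rintro φ ⟨⟨L, rfl⟩, hL, -⟩ x -
    refine ⟨?_, hL x⟩
    have := hL (-x)
    rw [map_neg] at this
    linarith
  obtain ⟨φ, hφ⟩ := IsCompact.nonempty_iInter_of_sequence_nonempty_isCompact_isClosed K
    (by
      rintro n φ ⟨⟨L, rfl⟩, hL, hn⟩
      refine ⟨⟨L, rfl⟩, hL, ?_⟩
      have h1 := hL (h (n + 1) - h n)
      rw [map_sub] at h1
      linarith [h_sub n])
    (by
      intro n
      obtain ⟨L, hL, hn⟩ := exists_linearMap_le_sublinear_apply_eq N N_hom N_add (h n)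
      exact ⟨L, ⟨L, rfl⟩, hL, hn ▸ h_le n⟩)
    hcompact hclosed
  rw [Set.mem_iInter] at hφ
  obtain ⟨⟨L, rfl⟩, hL, -⟩ := hφ 0
  exact ⟨L, hL, fun n => (hφ n).2.2⟩

/-! ### Bounded functions and domination by functions of one variable -/

/-- The bounded real functions on a set `X`. No measurability is asked for, so that a functional on
this space can be tested both on continuous functions of a pair and on measurable functions of one
variable. -/
def boundedFunctions (X : Type*) : Submodule ℝ (X → ℝ) where
  carrier := {f | ∃ C, ∀ x, |f x| ≤ C}
  zero_mem' := ⟨0, by simp⟩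
  add_mem' := by
    rintro f g ⟨C, hC⟩ ⟨D, hD⟩
    exact ⟨C + D, fun x => (abs_add_le _ _).trans (add_le_add (hC x) (hD x))⟩
  smul_mem' := by
    rintro t f ⟨C, hC⟩
    refine ⟨|t| * C, fun x => ?_⟩
    rw [Pi.smul_apply, smul_eq_mul, abs_mul]
    exact mul_le_mul_of_nonneg_left (hC x) (abs_nonneg t)

section MarginalCost

variable {T : Type*} [MeasurableSpace T] (μ ν : Measure T)

/-- The pair `(u, v)` of nonnegative measurable integrable functions dominates `h`, in the sense that
`h (x, y) ≤ u x + v y` at every point. -/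
structure IsMarginalBound (h : T × T → ℝ) (u v : T → ℝ) : Prop where
  measurable_left : Measurable u
  measurable_right : Measurable v
  integrable_left : Integrable u μ
  integrable_right : Integrable v ν
  nonneg_left : ∀ x, 0 ≤ u x
  nonneg_right : ∀ y, 0 ≤ v y
  le_add : ∀ x y, h (x, y) ≤ u x + v y

/-- The infimum of `∫ u dμ + ∫ v dν` over nonnegative `u`, `v` with `h (x, y) ≤ u x + v y`. A linear
functional below it is positive and, on nonnegative measurable functions of one variable, dominated by
integration against `μ` or `ν`. For unbounded `h` the set of such pairs may be empty, and the value is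
then `0`; only bounded `h` occur. -/
noncomputable def marginalCost (h : T × T → ℝ) : ℝ :=
  sInf {r | ∃ u v, IsMarginalBound μ ν h u v ∧ r = (∫ x, u x ∂μ) + ∫ y, v y ∂ν}

variable {μ ν}

theorem IsMarginalBound.marginalCost_le {h : T × T → ℝ} {u v : T → ℝ}
    (H : IsMarginalBound μ ν h u v) : marginalCost μ ν h ≤ (∫ x, u x ∂μ) + ∫ y, v y ∂ν := by
  refine csInf_le ⟨0, ?_⟩ ⟨u, v, H, rfl⟩
  rintro r ⟨u, v, H, rfl⟩
  exact add_nonneg (integral_nonneg H.nonneg_left) (integral_nonneg H.nonneg_right)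

theorem le_marginalCost [IsFiniteMeasure μ] {h : T × T → ℝ} (hh : h ∈ boundedFunctions (T × T))
    {r : ℝ} (H : ∀ u v, IsMarginalBound μ ν h u v → r ≤ (∫ x, u x ∂μ) + ∫ y, v y ∂ν) :
    r ≤ marginalCost μ ν h := by
  obtain ⟨C, hC⟩ := hh
  refine le_csInf ⟨_, fun _ => |C|, fun _ => 0, ⟨measurable_const, measurable_const,
    integrable_const _, integrable_zero _ _ _, fun _ => abs_nonneg C, fun _ => le_rfl,
    fun x y => ?_⟩, rfl⟩ ?_
  · rw [add_zero]
    exact (le_abs_self _).trans ((hC (x, y)).trans (le_abs_self C))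
  · rintro _ ⟨u, v, huv, rfl⟩
    exact H u v huv

theorem marginalCost_add_le [IsFiniteMeasure μ] {g h : T × T → ℝ}
    (hg : g ∈ boundedFunctions (T × T)) (hh : h ∈ boundedFunctions (T × T)) :
    marginalCost μ ν (g + h) ≤ marginalCost μ ν g + marginalCost μ ν h := by
  rw [← sub_le_iff_le_add]
  refine le_marginalCost hg fun u v H => ?_
  rw [sub_le_comm]
  refine le_marginalCost hh fun u' v' H' => ?_
  have key : IsMarginalBound μ ν (g + h) (u + u') (v + v') :=
    ⟨H.measurable_left.add H'.measurable_left, H.measurable_right.add H'.measurable_right,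
      H.integrable_left.add H'.integrable_left, H.integrable_right.add H'.integrable_right,
      fun x => add_nonneg (H.nonneg_left x) (H'.nonneg_left x),
      fun x => add_nonneg (H.nonneg_right x) (H'.nonneg_right x), fun x y => by
        have := H.le_add x y
        have := H'.le_add x y
        simp only [Pi.add_apply]
        linarith⟩
  have h1 := key.marginalCost_le
  simp only [Pi.add_apply] at h1
  rw [integral_add H.integrable_left H'.integrable_left,
    integral_add H.integrable_right H'.integrable_right] at h1
  linarith

theorem marginalCost_smul_le [IsFiniteMeasure μ] {h : T × T → ℝ}
    (hh : h ∈ boundedFunctions (T × T)) {t : ℝ} (ht : 0 < t) :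
    marginalCost μ ν (t • h) ≤ t * marginalCost μ ν h := by
  rw [← div_le_iff₀' ht]
  refine le_marginalCost hh fun u v H => ?_
  rw [div_le_iff₀' ht]
  have key : IsMarginalBound μ ν (t • h) (t • u) (t • v) :=
    ⟨H.measurable_left.const_smul t, H.measurable_right.const_smul t,
      H.integrable_left.smul t, H.integrable_right.smul t,
      fun x => mul_nonneg ht.le (H.nonneg_left x),
      fun x => mul_nonneg ht.le (H.nonneg_right x), fun x y => by
        simp only [Pi.smul_apply, smul_eq_mul, ← mul_add]
        exact mul_le_mul_of_nonneg_left (H.le_add x y) ht.le⟩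
  have h1 := key.marginalCost_le
  simp only [Pi.smul_apply, smul_eq_mul, integral_const_mul] at h1
  linarith

theorem marginalCost_smul [IsFiniteMeasure μ] {h : T × T → ℝ}
    (hh : h ∈ boundedFunctions (T × T)) {t : ℝ} (ht : 0 < t) :
    marginalCost μ ν (t • h) = t * marginalCost μ ν h := by
  refine le_antisymm (marginalCost_smul_le hh ht) ?_
  have h1 := marginalCost_smul_le (μ := μ) (ν := ν) (Submodule.smul_mem _ t hh) (inv_pos.2 ht)
  rw [smul_smul, inv_mul_cancel₀ ht.ne', one_smul, ← div_eq_inv_mul, le_div_iff₀' ht] at h1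
  exact h1

end MarginalCost

/-! ### From functionals to subcouplings -/

theorem continuous_mem_boundedFunctions {X : Type*} [TopologicalSpace X] [CompactSpace X]
    {h : X → ℝ} (hh : Continuous h) : h ∈ boundedFunctions X := by
  obtain ⟨C, hC⟩ := isCompact_univ.exists_bound_of_continuousOn hh.continuousOn
  exact ⟨C, fun x => hC x (Set.mem_univ x)⟩

theorem boundedFunctions_comp {X Y : Type*} {f : Y → ℝ} (hf : f ∈ boundedFunctions Y)
    (π : X → Y) : f ∘ π ∈ boundedFunctions X := by
  obtain ⟨C, hC⟩ := hf
  exact ⟨C, fun x => hC (π x)⟩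

theorem integrable_of_mem_boundedFunctions {X : Type*} [MeasurableSpace X] {ρ : Measure X}
    [IsFiniteMeasure ρ] {f : X → ℝ} (hf : Measurable f) (hb : f ∈ boundedFunctions X) :
    Integrable f ρ := by
  obtain ⟨C, hC⟩ := hb
  exact Integrable.of_bound hf.aestronglyMeasurable C (ae_of_all _ hC)

theorem measure_le_of_forall_integral_le {T : Type*} [TopologicalSpace T] [HasOuterApproxClosed T]
    [MeasurableSpace T] [BorelSpace T] (ρ μ : Measure T) [IsFiniteMeasure ρ] [IsFiniteMeasure μ]
    [ρ.WeaklyRegular]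
    (H : ∀ g : T → ℝ, Continuous g → (∀ x, 0 ≤ g x) → g ∈ boundedFunctions T →
      ∫ x, g x ∂ρ ≤ ∫ x, g x ∂μ) : ρ ≤ μ := by
  have hclosed : ∀ F : Set T, IsClosed F → ρ F ≤ μ F := by
    intro F hF
    refine le_of_tendsto_of_tendsto'
      (HasOuterApproxClosed.tendsto_lintegral_apprSeq hF ρ)
      (HasOuterApproxClosed.tendsto_lintegral_apprSeq hF μ) fun n => ?_
    have hcont : Continuous fun x => ((hF.apprSeq n x : NNReal) : ℝ) :=
      NNReal.continuous_coe.comp (hF.apprSeq n).continuous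
    have hmem : (fun x => ((hF.apprSeq n x : NNReal) : ℝ)) ∈ boundedFunctions T :=
      ⟨1, fun x => by
        rw [abs_of_nonneg (NNReal.coe_nonneg _)]
        exact_mod_cast HasOuterApproxClosed.apprSeq_apply_le_one hF n x⟩
    have h1 := H _ hcont (fun x => NNReal.coe_nonneg _) hmem
    have h2 : ∀ σ : Measure T, [IsFiniteMeasure σ] → ∫⁻ x, (hF.apprSeq n x : ENNReal) ∂σ
        = ENNReal.ofReal (∫ x, ((hF.apprSeq n x : NNReal) : ℝ) ∂σ) := by
      intro σ _
      rw [ofReal_integral_eq_lintegral_ofReal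
        (integrable_of_mem_boundedFunctions hcont.measurable hmem)
        (ae_of_all _ fun x => NNReal.coe_nonneg _)]
      simp
    rw [h2, h2]
    exact ENNReal.ofReal_le_ofReal h1
  refine Measure.le_iff.2 fun A hA => ?_
  rw [hA.measure_eq_iSup_isClosed_of_ne_top (measure_ne_top ρ A)]
  exact iSup_le fun F => iSup_le fun hFA => iSup_le fun hF =>
    (hclosed F hF).trans (measure_mono hFA)

/-- If a linear functional composed with `π` is integration against `ρ` on continuous functions and
is bounded by the `L¹(μ)` seminorm on bounded measurable ones, then `ρ ≤ μ`, and by density of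
continuous functions in `L¹(μ)` the representation extends to all bounded measurable functions. -/
theorem apply_comp_eq_integral_map {X T : Type*} [MeasurableSpace X] [TopologicalSpace T]
    [HasOuterApproxClosed T] [NormalSpace T] [MeasurableSpace T] [BorelSpace T]
    (L : boundedFunctions X →ₗ[ℝ] ℝ) (π : X → T) (ρ μ : Measure T) [IsFiniteMeasure ρ]
    [IsFiniteMeasure μ] [ρ.WeaklyRegular] [μ.WeaklyRegular]
    (hcont : ∀ g : T → ℝ, Continuous g → ∀ hg : g ∈ boundedFunctions T,
      L ⟨g ∘ π, boundedFunctions_comp hg π⟩ = ∫ x, g x ∂ρ)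
    (hle : ∀ f : T → ℝ, Measurable f → ∀ hf : f ∈ boundedFunctions T,
      L ⟨f ∘ π, boundedFunctions_comp hf π⟩ ≤ ∫ x, |f x| ∂μ) :
    ρ ≤ μ ∧ ∀ f : T → ℝ, Measurable f → ∀ hf : f ∈ boundedFunctions T,
      L ⟨f ∘ π, boundedFunctions_comp hf π⟩ = ∫ x, f x ∂ρ := by
  have hρμ : ρ ≤ μ := by
    refine measure_le_of_forall_integral_le ρ μ fun g hg hg0 hgb => ?_
    rw [← hcont g hg hgb]
    refine (hle g hg.measurable hgb).trans_eq ?_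
    simp only [abs_of_nonneg (hg0 _)]
  refine ⟨hρμ, ?_⟩
  have key : ∀ f : T → ℝ, Measurable f → ∀ hf : f ∈ boundedFunctions T,
      L ⟨f ∘ π, boundedFunctions_comp hf π⟩ ≤ ∫ x, f x ∂ρ := by
    intro f hfm hf
    refine le_of_forall_pos_le_add fun ε hε => ?_
    have hfμ : Integrable f μ := integrable_of_mem_boundedFunctions hfm hf
    obtain ⟨g, hg, hgμ⟩ := hfμ.exists_boundedContinuous_integral_sub_le (half_pos hε)
    have hgb : ⇑g ∈ boundedFunctions T := ⟨‖g‖, fun x => g.norm_coe_le_norm x⟩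
    have hsub : f - ⇑g ∈ boundedFunctions T := Submodule.sub_mem _ hf hgb
    have h1 := hle (f - ⇑g) (hfm.sub g.continuous.measurable) hsub
    have h2 : L ⟨(f - ⇑g) ∘ π, boundedFunctions_comp hsub π⟩
        = L ⟨f ∘ π, boundedFunctions_comp hf π⟩ - L ⟨g ∘ π, boundedFunctions_comp hgb π⟩ := by
      rw [← map_sub]
      rfl
    rw [hcont g g.continuous hgb] at h2
    have hint : Integrable (fun x => |f x - g x|) μ := (hfμ.sub hgμ).abs
    have hfρ : Integrable f ρ := hfμ.mono_measure hρμ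
    have hgρ : Integrable g ρ := hgμ.mono_measure hρμ
    have h3 : ∫ x, |f x - g x| ∂ρ ≤ ∫ x, |f x - g x| ∂μ :=
      integral_mono_measure hρμ (ae_of_all _ fun x => abs_nonneg _) hint
    have h4 : |∫ x, (g x - f x) ∂ρ| ≤ ∫ x, |f x - g x| ∂ρ := by
      simp only [abs_sub_comm (f _)]
      exact abs_integral_le_integral_abs
    rw [integral_sub hgρ hfρ] at h4
    have h5 := le_abs_self ((∫ x, g x ∂ρ) - ∫ x, f x ∂ρ)
    simp only [Real.norm_eq_abs] at hg
    simp only [Pi.sub_apply] at h1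
    linarith
  intro f hfm hf
  refine le_antisymm (key f hfm hf) ?_
  have h1 := key (-f) hfm.neg (Submodule.neg_mem _ hf)
  have h2 : L ⟨(-f) ∘ π, boundedFunctions_comp (Submodule.neg_mem _ hf) π⟩
      = - L ⟨f ∘ π, boundedFunctions_comp hf π⟩ := by
    rw [← map_neg]
    rfl
  simp only [Pi.neg_apply, integral_neg] at h1
  linarith

/-- Riesz-Markov-Kakutani for a positive functional that is defined on all bounded functions: its
restriction to the continuous functions is integration against a finite measure. -/
theorem exists_measure_eq_of_nonneg {X : Type*} [TopologicalSpace X] [CompactSpace X] [T2Space X]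
    [MeasurableSpace X] [BorelSpace X] (L : boundedFunctions X →ₗ[ℝ] ℝ)
    (hL : ∀ h, (∀ x, 0 ≤ h.1 x) → 0 ≤ L h) :
    ∃ γ : Measure X, IsFiniteMeasure γ ∧
      ∀ (h : X → ℝ) (hc : Continuous h), L ⟨h, continuous_mem_boundedFunctions hc⟩ = ∫ x, h x ∂γ := by
  let Λ₀ : C_c(X, ℝ) →ₗ[ℝ] ℝ :=
    { toFun := fun f => L ⟨f, continuous_mem_boundedFunctions f.continuous⟩
      map_add' := fun f g => by
        rw [← map_add]
        rfl
      map_smul' := fun t f => by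
        rw [RingHom.id_apply, ← map_smul]
        rfl }
  let Λ : C_c(X, ℝ) →ₚ[ℝ] ℝ := PositiveLinearMap.mk₀ Λ₀ fun f hf => hL _ hf
  refine ⟨RealRMK.rieszMeasure Λ, ⟨isCompact_univ.measure_lt_top⟩, fun h hc => ?_⟩
  exact (RealRMK.integral_rieszMeasure Λ ⟨⟨h, hc⟩, HasCompactSupport.of_compactSpace h⟩).symm

/-- A linear functional below `marginalCost μ ν` is represented by a subcoupling, on continuous
functions of the pair and on bounded measurable functions of either coordinate. -/
theorem exists_subcoupling_of_le_marginalCost {T : Type*} [TopologicalSpace T] [CompactSpace T]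
    [TopologicalSpace.MetrizableSpace T] [MeasurableSpace T] [BorelSpace T]
    (μ ν : Measure T) [IsFiniteMeasure μ] [IsFiniteMeasure ν]
    (L : boundedFunctions (T × T) →ₗ[ℝ] ℝ) (hL : ∀ h, L h ≤ marginalCost μ ν h.1) :
    ∃ γ ∈ subcouplings μ ν,
      (∀ (h : T × T → ℝ) (hc : Continuous h),
        L ⟨h, continuous_mem_boundedFunctions hc⟩ = ∫ p, h p ∂γ) ∧
      (∀ f : T → ℝ, Measurable f → ∀ hf : f ∈ boundedFunctions T,
        L ⟨f ∘ Prod.fst, boundedFunctions_comp hf _⟩ = ∫ x, f x ∂γ.fst) ∧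
      (∀ f : T → ℝ, Measurable f → ∀ hf : f ∈ boundedFunctions T,
        L ⟨f ∘ Prod.snd, boundedFunctions_comp hf _⟩ = ∫ y, f y ∂γ.snd) := by
  let _ := TopologicalSpace.metrizableSpaceMetric T
  have hpos : ∀ h, (∀ x, 0 ≤ h.1 x) → 0 ≤ L h := by
    intro h hh
    have key : IsMarginalBound μ ν (-h).1 (fun _ => 0) (fun _ => 0) :=
      ⟨measurable_const, measurable_const, integrable_zero _ _ _, integrable_zero _ _ _,
        fun _ => le_rfl, fun _ => le_rfl, fun x y => by
          simpa using hh (x, y)⟩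
    have h1 := (hL (-h)).trans key.marginalCost_le
    simp only [map_neg, integral_zero] at h1
    linarith
  obtain ⟨γ, hγ, hγL⟩ := exists_measure_eq_of_nonneg L hpos
  have hfst := apply_comp_eq_integral_map L Prod.fst γ.fst μ
    (fun g hg _ => by
      rw [Measure.fst, integral_map measurable_fst.aemeasurable
        hg.measurable.aestronglyMeasurable]
      exact hγL (g ∘ Prod.fst) (hg.comp continuous_fst))
    (fun f hfm hf => by
      have key : IsMarginalBound μ ν (f ∘ Prod.fst) (fun x => |f x|) (fun _ => 0) :=
        ⟨hfm.abs, measurable_const, (integrable_of_mem_boundedFunctions hfm hf).abs,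
          integrable_zero _ _ _, fun _ => abs_nonneg _, fun _ => le_rfl, fun x y => by
            simpa using le_abs_self (f x)⟩
      simpa using (hL ⟨f ∘ Prod.fst, boundedFunctions_comp hf _⟩).trans key.marginalCost_le)
  have hsnd := apply_comp_eq_integral_map L Prod.snd γ.snd ν
    (fun g hg _ => by
      rw [Measure.snd, integral_map measurable_snd.aemeasurable
        hg.measurable.aestronglyMeasurable]
      exact hγL (g ∘ Prod.snd) (hg.comp continuous_snd))
    (fun f hfm hf => by
      have key : IsMarginalBound μ ν (f ∘ Prod.snd) (fun _ => 0) (fun x => |f x|) :=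
        ⟨measurable_const, hfm.abs, integrable_zero _ _ _,
          (integrable_of_mem_boundedFunctions hfm hf).abs, fun _ => le_rfl,
          fun _ => abs_nonneg _, fun x y => by
            simpa using le_abs_self (f y)⟩
      simpa using (hL ⟨f ∘ Prod.snd, boundedFunctions_comp hf _⟩).trans key.marginalCost_le)
  exact ⟨γ, ⟨hγ, hfst.1, hsnd.1⟩, hγL, hfst.2, hsnd.2⟩

/-! ### The penalty of a marginal -/

section MarginalPenalty

variable {T : Type*} [MeasurableSpace T] {ρ μ : Measure T} [IsFiniteMeasure μ]

theorem ae_one_sub_rnDeriv_nonneg (hρ : ρ ≤ μ) :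
    ∀ᵐ x ∂μ, 0 ≤ 1 - (ρ.rnDeriv μ x).toReal := by
  filter_upwards [Measure.rnDeriv_le_one_of_le hρ] with x hx
  rw [sub_nonneg]
  exact ENNReal.toReal_le_of_le_ofReal zero_le_one (by simpa using hx)

/-- Monotone convergence of the penalties for the truncated weights `min w n`. -/
theorem tendsto_lintegral_min_mul_one_sub_rnDeriv (hρ : ρ ≤ μ) {w : T → ℝ} (hw : Measurable w) :
    Tendsto (fun n : ℕ => ∫⁻ x, ENNReal.ofReal (min (w x) n * (1 - (ρ.rnDeriv μ x).toReal)) ∂μ)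
      atTop (𝓝 (∫⁻ x, ENNReal.ofReal (w x * (1 - (ρ.rnDeriv μ x).toReal)) ∂μ)) := by
  refine lintegral_tendsto_of_tendsto_of_monotone (fun n => ?_) ?_ ?_
  · exact ((hw.min measurable_const).mul
      (measurable_const.sub
        (Measure.measurable_rnDeriv ρ μ).ennreal_toReal)).ennreal_ofReal.aemeasurable
  · filter_upwards [ae_one_sub_rnDeriv_nonneg hρ] with x hx m n hmn
    refine ENNReal.ofReal_le_ofReal (mul_le_mul_of_nonneg_right ?_ hx)
    exact min_le_min_left _ (by exact_mod_cast hmn)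
  · refine ae_of_all _ fun x => tendsto_const_nhds.congr' ?_
    obtain ⟨N, hN⟩ := exists_nat_ge (w x)
    filter_upwards [eventually_ge_atTop N] with n hn
    rw [min_eq_left (hN.trans (by exact_mod_cast hn))]

variable [IsFiniteMeasure ρ]

theorem integrable_mul_one_sub_rnDeriv (hρ : ρ ≤ μ) {u : T → ℝ} (hu : Integrable u μ) :
    Integrable (fun x => u x * (1 - (ρ.rnDeriv μ x).toReal)) μ := by
  have h1 := (integrable_rnDeriv_smul_iff hρ.absolutelyContinuous).2 (hu.mono_measure hρ)
  refine (hu.sub h1).congr (ae_of_all _ fun x => ?_)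
  simp only [Pi.sub_apply, smul_eq_mul]
  ring

theorem integral_mul_one_sub_rnDeriv (hρ : ρ ≤ μ) {u : T → ℝ} (hu : Integrable u μ) :
    ∫ x, u x * (1 - (ρ.rnDeriv μ x).toReal) ∂μ = (∫ x, u x ∂μ) - ∫ x, u x ∂ρ := by
  have h1 := (integrable_rnDeriv_smul_iff hρ.absolutelyContinuous).2 (hu.mono_measure hρ)
  rw [← integral_rnDeriv_smul hρ.absolutelyContinuous (f := u), ← integral_sub hu h1]
  refine integral_congr_ae (ae_of_all _ fun x => ?_)
  simp only [smul_eq_mul]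
  ring

/-- The real left side is `∫ u (1 - f) dμ` with `f = dρ/dμ ≤ 1`. The right side may be `∞`, as `w` need
not be integrable. -/
theorem integral_sub_integral_le_lintegral (hρ : ρ ≤ μ) {u w : T → ℝ} (hu : Integrable u μ)
    (huw : ∀ x, u x ≤ w x) :
    (((∫ x, u x ∂μ) - ∫ x, u x ∂ρ : ℝ) : EReal)
      ≤ ((∫⁻ x, ENNReal.ofReal (w x * (1 - (ρ.rnDeriv μ x).toReal)) ∂μ : ENNReal) : EReal) := by
  set A := ∫⁻ x, ENNReal.ofReal (w x * (1 - (ρ.rnDeriv μ x).toReal)) ∂μ with hA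
  by_cases htop : A = ⊤
  · rw [htop]
    exact le_top
  rw [← EReal.coe_ennreal_toReal htop, EReal.coe_le_coe_iff, ← integral_mul_one_sub_rnDeriv hρ hu,
    integral_eq_lintegral_pos_part_sub_lintegral_neg_part (integrable_mul_one_sub_rnDeriv hρ hu)]
  refine (sub_le_self _ ENNReal.toReal_nonneg).trans (ENNReal.toReal_mono htop ?_)
  refine lintegral_mono_ae ?_
  filter_upwards [ae_one_sub_rnDeriv_nonneg hρ] with x hx
  exact ENNReal.ofReal_le_ofReal (mul_le_mul_of_nonneg_right (huw x) hx)

theorem lintegral_mul_one_sub_rnDeriv (hρ : ρ ≤ μ) {w : T → ℝ} (hw : Integrable w μ)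
    (hw0 : ∀ x, 0 ≤ w x) :
    ∫⁻ x, ENNReal.ofReal (w x * (1 - (ρ.rnDeriv μ x).toReal)) ∂μ
      = ENNReal.ofReal ((∫ x, w x ∂μ) - ∫ x, w x ∂ρ) := by
  rw [← integral_mul_one_sub_rnDeriv hρ hw,
    ofReal_integral_eq_lintegral_ofReal (integrable_mul_one_sub_rnDeriv hρ hw)]
  filter_upwards [ae_one_sub_rnDeriv_nonneg hρ] with x hx using mul_nonneg (hw0 x) hx

end MarginalPenalty

/-! ### Duality -/

/-- The lower bound in `dualClass` costs nothing: the second component `v` of a pair that satisfies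
the other constraints can be raised to `max v l`, where `l` is the lower bound. The pair stays
feasible because `l y ≤ b (c x y - lam) - w₁ x` for every `x`, which gives `u x + l y ≤ b (c x y - lam)`
and, at `x = y`, `l y ≤ 0 ≤ w₂ y`. -/
theorem exists_mem_dualClass_of_feasible {T : Type*} [TopologicalSpace T] [MeasurableSpace T]
    [BorelSpace T] {μ ν : Measure T} {b : ℝ} {c : T → T → ℝ} {lam : ℝ} {w₁ w₂ : T → ℝ} (hb : 0 ≤ b)
    (hc : Continuous fun p : T × T => c p.1 p.2) (hc0 : ∀ x, c x x = 0)
    (hw₁ : ∀ x, 0 ≤ w₁ x) (hw₂ : ∀ x, 0 ≤ w₂ x) (hlam : 0 ≤ lam) {u v : T → ℝ}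
    (hu : Integrable u μ) (hvm : Measurable v) (hv : Integrable v ν) (huw : ∀ x, u x ≤ w₁ x)
    (hvw : ∀ y, v y ≤ w₂ y) (huv : ∀ x y, u x + v y ≤ b * (c x y - lam)) :
    ∃ v' : T → ℝ, (u, v') ∈ dualClass b c lam w₁ w₂ μ ν ∧ ∫ y, v y ∂ν ≤ ∫ y, v' y ∂ν := by
  set l : T → EReal :=
    fun y => ((-(b * lam) : ℝ) : EReal) + ⨅ x, ((b * c x y - w₁ x : ℝ) : EReal) with hl
  have hl_le : ∀ x y, l y ≤ ((b * (c x y - lam) - w₁ x : ℝ) : EReal) := by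
    intro x y
    refine (add_le_add_right (iInf_le _ x) _).trans ?_
    rw [← EReal.coe_add, EReal.coe_le_coe_iff]
    linarith
  have hl_nonpos : ∀ y, l y ≤ ((0 : ℝ) : EReal) := by
    intro y
    refine (hl_le y y).trans (EReal.coe_le_coe_iff.2 ?_)
    rw [hc0]
    have := mul_nonneg hb hlam
    have := hw₁ y
    linarith
  have hlm : Measurable l := by
    refine Measurable.const_add (UpperSemicontinuous.measurable (upperSemicontinuous_iInf ?_)) _
    intro x
    refine Continuous.upperSemicontinuous (continuous_coe_real_ereal.comp ?_)
    have : Continuous fun y => c x y := hc.comp (continuous_const.prodMk continuous_id)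
    fun_prop
  -- `l` may be `⊥`, but the maximum with `v` is finite, so `toReal` takes no junk value.
  have hmax : ∀ y, (((max (v y : EReal) (l y)).toReal : ℝ) : EReal) = max (v y : EReal) (l y) := by
    intro y
    refine EReal.coe_toReal ?_ ?_
    · refine ne_of_lt (max_lt (EReal.coe_lt_top _) ((hl_nonpos y).trans_lt (EReal.coe_lt_top _)))
    · exact ne_of_gt ((EReal.bot_lt_coe _).trans_le (le_max_left _ _))
  set v' : T → ℝ := fun y => (max (v y : EReal) (l y)).toReal with hv'
  have hv'_le : ∀ (y : T) (r : ℝ), v y ≤ r → l y ≤ (r : EReal) → v' y ≤ r := by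
    intro y r h1 h2
    rw [← EReal.coe_le_coe_iff, hmax]
    exact max_le (EReal.coe_le_coe_iff.2 h1) h2
  have hv_le : ∀ y, v y ≤ v' y := by
    intro y
    rw [← EReal.coe_le_coe_iff, hmax]
    exact le_max_left _ _
  have hv'm : Measurable v' :=
    measurable_ereal_toReal.comp (hvm.coe_real_ereal.max hlm)
  have hv'i : Integrable v' ν := by
    refine hv.abs.mono' hv'm.aestronglyMeasurable (ae_of_all _ fun y => ?_)
    rw [Real.norm_eq_abs, abs_le]
    refine ⟨(neg_abs_le _).trans (hv_le y), hv'_le y _ (le_abs_self _) ((hl_nonpos y).trans ?_)⟩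
    exact EReal.coe_le_coe_iff.2 (abs_nonneg _)
  refine ⟨v', ⟨hu, hv'i, huw, fun y => ?_, fun y => ?_, fun x y => ?_⟩,
    integral_mono hv hv'i hv_le⟩
  · show l y ≤ (v' y : EReal)
    rw [hmax]
    exact le_max_right _ _
  · exact hv'_le y _ (hvw y) ((hl_nonpos y).trans (EReal.coe_le_coe_iff.2 (hw₂ y)))
  · have h1 : v' y ≤ b * (c x y - lam) - u x := by
      refine hv'_le y _ (by linarith [huv x y]) ((hl_le x y).trans (EReal.coe_le_coe_iff.2 ?_))
      linarith [huw x]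
    show u x + v' y ≤ _
    linarith

theorem min_natCast_mem_boundedFunctions {X : Type*} {w : X → ℝ} (hw : ∀ x, 0 ≤ w x) (n : ℕ) :
    (fun x => min (w x) (n : ℝ)) ∈ boundedFunctions X :=
  ⟨n, fun x => by
    rw [abs_of_nonneg (le_min (hw x) n.cast_nonneg)]
    exact min_le_right _ _⟩

section Duality

variable {T : Type*} [TopologicalSpace T] [CompactSpace T] [TopologicalSpace.MetrizableSpace T]
  [MeasurableSpace T] [BorelSpace T] {μ ν : Measure T} [IsFiniteMeasure μ] [IsFiniteMeasure ν]
  {b : ℝ} {c : T → T → ℝ} {lam : ℝ} {w₁ w₂ : T → ℝ}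

/-- Weak duality. -/
theorem dual_le_eptCost (hc : Continuous fun p : T × T => c p.1 p.2) {u v : T → ℝ}
    (huv : (u, v) ∈ dualClass b c lam w₁ w₂ μ ν) {γ : Measure (T × T)}
    (hγ : γ ∈ subcouplings μ ν) :
    (((∫ x, u x ∂μ) + ∫ y, v y ∂ν : ℝ) : EReal) ≤ eptCost b c lam w₁ w₂ μ ν γ := by
  let _ := TopologicalSpace.metrizableSpaceMetric T
  obtain ⟨hfin, h₁, h₂⟩ := hγ
  obtain ⟨hu, hv, huw, -, hvw, hcost⟩ := huv
  have e₁ := integral_sub_integral_le_lintegral h₁ hu huw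
  have e₂ := integral_sub_integral_le_lintegral h₂ hv hvw
  have huγ : Integrable (fun p : T × T => u p.1) γ :=
    (hu.mono_measure h₁).comp_measurable measurable_fst
  have hvγ : Integrable (fun p : T × T => v p.2) γ :=
    (hv.mono_measure h₂).comp_measurable measurable_snd
  have hcγ : Integrable (fun p : T × T => b * (c p.1 p.2 - lam)) γ := by
    have hcont : Continuous fun p : T × T => b * (c p.1 p.2 - lam) := by fun_prop
    exact integrable_of_mem_boundedFunctions hcont.measurable
      (continuous_mem_boundedFunctions hcont)
  have e₃ : (∫ x, u x ∂γ.fst) + ∫ y, v y ∂γ.snd ≤ b * ∫ p, (c p.1 p.2 - lam) ∂γ := by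
    rw [Measure.fst, Measure.snd,
      integral_map measurable_fst.aemeasurable (hu.mono_measure h₁).aestronglyMeasurable,
      integral_map measurable_snd.aemeasurable (hv.mono_measure h₂).aestronglyMeasurable,
      ← integral_add huγ hvγ, ← integral_const_mul]
    exact integral_mono (huγ.add hvγ) hcγ fun p => hcost p.1 p.2
  refine le_trans ?_ (add_le_add (add_le_add e₁ e₂) (EReal.coe_le_coe_iff.2 e₃))
  rw [← EReal.coe_add, ← EReal.coe_add, EReal.coe_le_coe_iff]
  linarith

/-- Strong duality: for every real upper bound `D` of the dual problem there is a subcoupling of cost at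
most `D`. -/
theorem exists_eptCost_le (hb : 0 ≤ b)
    (hc : Continuous fun p : T × T => c p.1 p.2) (hc0 : ∀ x, c x x = 0)
    (hw₁m : Measurable w₁) (hw₂m : Measurable w₂)
    (hw₁ : ∀ x, 0 ≤ w₁ x) (hw₂ : ∀ x, 0 ≤ w₂ x) (hlam : 0 ≤ lam) {D : ℝ}
    (hD : ∀ u v, (u, v) ∈ dualClass b c lam w₁ w₂ μ ν → (∫ x, u x ∂μ) + ∫ y, v y ∂ν ≤ D) :
    ∃ γ ∈ subcouplings μ ν, eptCost b c lam w₁ w₂ μ ν γ ≤ (D : EReal) := by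
  have hkc : Continuous fun p : T × T => b * (c p.1 p.2 - lam) := by fun_prop
  let k : boundedFunctions (T × T) := ⟨_, continuous_mem_boundedFunctions hkc⟩
  have hb₁ := min_natCast_mem_boundedFunctions hw₁
  have hb₂ := min_natCast_mem_boundedFunctions hw₂
  have hm₁ : ∀ n : ℕ, Measurable fun x => min (w₁ x) (n : ℝ) := fun n => hw₁m.min measurable_const
  have hm₂ : ∀ n : ℕ, Measurable fun x => min (w₂ x) (n : ℝ) := fun n => hw₂m.min measurable_const
  have hi₁ : ∀ (σ : Measure T) [IsFiniteMeasure σ] (n : ℕ),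
      Integrable (fun x => min (w₁ x) (n : ℝ)) σ :=
    fun σ _ n => integrable_of_mem_boundedFunctions (hm₁ n) (hb₁ n)
  have hi₂ : ∀ (σ : Measure T) [IsFiniteMeasure σ] (n : ℕ),
      Integrable (fun x => min (w₂ x) (n : ℝ)) σ :=
    fun σ _ n => integrable_of_mem_boundedFunctions (hm₂ n) (hb₂ n)
  -- With `hₙ = min w₁ n + min w₂ n - b (c - lam)`, the cost of `γ` for the truncated weights is
  -- `∫ min w₁ n dμ + ∫ min w₂ n dν - ∫ hₙ dγ`, so it is at most `D` when `aₙ ≤ ∫ hₙ dγ`.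
  let h : ℕ → boundedFunctions (T × T) := fun n =>
    ⟨_, boundedFunctions_comp (hb₁ n) Prod.fst⟩ + ⟨_, boundedFunctions_comp (hb₂ n) Prod.snd⟩ - k
  let a : ℕ → ℝ := fun n =>
    (∫ x, min (w₁ x) (n : ℝ) ∂μ) + (∫ y, min (w₂ y) (n : ℝ) ∂ν) - D
  have h_apply : ∀ n x y, (h n).1 (x, y)
      = min (w₁ x) (n : ℝ) + min (w₂ y) (n : ℝ) - b * (c x y - lam) := fun n x y => rfl
  obtain ⟨L, hL, haL⟩ := exists_linearMap_le_sublinear_of_seq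
    (fun g : boundedFunctions (T × T) => marginalCost μ ν g.1)
    (fun t ht g => marginalCost_smul g.2 ht) (fun f g => marginalCost_add_le f.2 g.2) h a
    (fun n => by
      -- A pair `(u, v)` dominating `hₙ` gives the dual candidate `(min w₁ n - u, min w₂ n - v)`.
      refine le_marginalCost (h n).2 fun u v H => ?_
      obtain ⟨v', hv', hle⟩ := exists_mem_dualClass_of_feasible (μ := μ) (ν := ν) hb hc hc0 hw₁ hw₂
        hlam (u := fun x => min (w₁ x) (n : ℝ) - u x) (v := fun y => min (w₂ y) (n : ℝ) - v y)
        ((hi₁ μ n).sub H.integrable_left) ((hm₂ n).sub H.measurable_right)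
        ((hi₂ ν n).sub H.integrable_right)
        (fun x => (sub_le_self _ (H.nonneg_left x)).trans (min_le_left _ _))
        (fun y => (sub_le_self _ (H.nonneg_right y)).trans (min_le_left _ _))
        (fun x y => by
          have := H.le_add x y
          rw [h_apply] at this
          linarith)
      have h1 := hD _ _ hv'
      rw [integral_sub (hi₁ μ n) H.integrable_left] at h1
      rw [integral_sub (hi₂ ν n) H.integrable_right] at hle
      simp only [a]
      linarith)
    (fun n => by
      have hmono : ∀ r : ℝ, min r (n : ℝ) ≤ min r ((n + 1 : ℕ) : ℝ) := fun r =>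
        min_le_min_left _ (by exact_mod_cast n.le_succ)
      have key : IsMarginalBound μ ν (h (n + 1) - h n).1
          (fun x => min (w₁ x) ((n + 1 : ℕ) : ℝ) - min (w₁ x) (n : ℝ))
          (fun y => min (w₂ y) ((n + 1 : ℕ) : ℝ) - min (w₂ y) (n : ℝ)) :=
        ⟨(hm₁ _).sub (hm₁ _), (hm₂ _).sub (hm₂ _), (hi₁ μ _).sub (hi₁ μ _),
          (hi₂ ν _).sub (hi₂ ν _), fun x => sub_nonneg.2 (hmono _), fun y => sub_nonneg.2 (hmono _),
          fun x y => by
            have e : (h (n + 1) - h n).1 (x, y) = (h (n + 1)).1 (x, y) - (h n).1 (x, y) := rfl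
            rw [e, h_apply, h_apply]
            linarith⟩
      refine key.marginalCost_le.trans_eq ?_
      rw [integral_sub (hi₁ μ _) (hi₁ μ _), integral_sub (hi₂ ν _) (hi₂ ν _)]
      simp only [a]
      ring)
  obtain ⟨γ, hγ, hγc, hγ₁, hγ₂⟩ := exists_subcoupling_of_le_marginalCost μ ν L hL
  refine ⟨γ, hγ, ?_⟩
  obtain ⟨hfin, h₁, h₂⟩ := hγ
  set κ : ℝ := b * ∫ p, (c p.1 p.2 - lam) ∂γ with hκ
  have hpen₁ : ∀ n : ℕ, 0 ≤ (∫ x, min (w₁ x) (n : ℝ) ∂μ) - ∫ x, min (w₁ x) (n : ℝ) ∂γ.fst :=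
    fun n => sub_nonneg.2 (integral_mono_measure h₁
      (ae_of_all _ fun x => le_min (hw₁ x) n.cast_nonneg) (hi₁ μ n))
  have hpen₂ : ∀ n : ℕ, 0 ≤ (∫ x, min (w₂ x) (n : ℝ) ∂ν) - ∫ x, min (w₂ x) (n : ℝ) ∂γ.snd :=
    fun n => sub_nonneg.2 (integral_mono_measure h₂
      (ae_of_all _ fun x => le_min (hw₂ x) n.cast_nonneg) (hi₂ ν n))
  have hbound : ∀ n : ℕ, ((∫ x, min (w₁ x) (n : ℝ) ∂μ) - ∫ x, min (w₁ x) (n : ℝ) ∂γ.fst)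
      + ((∫ x, min (w₂ x) (n : ℝ) ∂ν) - ∫ x, min (w₂ x) (n : ℝ) ∂γ.snd) ≤ D - κ := by
    intro n
    have h1 := haL n
    simp only [h, a, map_sub, map_add] at h1
    rw [hγ₁ _ (hm₁ n) (hb₁ n), hγ₂ _ (hm₂ n) (hb₂ n), hγc _ hkc, integral_const_mul] at h1
    linarith
  have hDκ : 0 ≤ D - κ := (add_nonneg (hpen₁ 0) (hpen₂ 0)).trans (hbound 0)
  have hlim : (∫⁻ x, ENNReal.ofReal (w₁ x * (1 - (γ.fst.rnDeriv μ x).toReal)) ∂μ)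
      + (∫⁻ y, ENNReal.ofReal (w₂ y * (1 - (γ.snd.rnDeriv ν y).toReal)) ∂ν)
      ≤ ENNReal.ofReal (D - κ) := by
    refine le_of_tendsto' ((tendsto_lintegral_min_mul_one_sub_rnDeriv h₁ hw₁m).add
      (tendsto_lintegral_min_mul_one_sub_rnDeriv h₂ hw₂m)) fun n => ?_
    rw [lintegral_mul_one_sub_rnDeriv h₁ (hi₁ μ n) fun x => le_min (hw₁ x) n.cast_nonneg,
      lintegral_mul_one_sub_rnDeriv h₂ (hi₂ ν n) fun x => le_min (hw₂ x) n.cast_nonneg,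
      ← ENNReal.ofReal_add (hpen₁ n) (hpen₂ n)]
    exact ENNReal.ofReal_le_ofReal (hbound n)
  have hlim' := EReal.coe_ennreal_le_coe_ennreal_iff.2 hlim
  rw [EReal.coe_ennreal_add, EReal.coe_ennreal_ofReal, max_eq_left hDκ] at hlim'
  refine (add_le_add_left hlim' _).trans ?_
  rw [← EReal.coe_add, EReal.coe_le_coe_iff]
  linarith

end Duality

theorem theorem3p4 {T : Type*} [TopologicalSpace T] [CompactSpace T]
    [TopologicalSpace.MetrizableSpace T] [MeasurableSpace T] [BorelSpace T]
    (μ ν : Measure T) [IsFiniteMeasure μ] [IsFiniteMeasure ν]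
    (b : ℝ) (hb : 0 ≤ b)
    (c : T → T → ℝ) (hc : Continuous fun p : T × T => c p.1 p.2) (hc0 : ∀ x, c x x = 0)
    (w₁ w₂ : T → ℝ) (hw₁m : Measurable w₁) (hw₂m : Measurable w₂)
    (hw₁ : ∀ x, 0 ≤ w₁ x) (hw₂ : ∀ x, 0 ≤ w₂ x)
    (lam : ℝ) (hlam : 0 ≤ lam) :
    ET b c lam w₁ w₂ μ ν =
      ⨆ p ∈ dualClass b c lam w₁ w₂ μ ν,
        (((∫ x, p.1 x ∂μ) + (∫ y, p.2 y ∂ν) : ℝ) : EReal) := by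
  refine le_antisymm ?_ (iSup₂_le fun p hp => le_iInf₂ fun γ hγ => dual_le_eptCost hc hp hγ)
  -- It suffices to bound `ET` by each real `D` above the supremum; there are none if that is `⊤`.
  refine EReal.le_of_forall_lt_iff_le.1 fun D hD => ?_
  obtain ⟨γ, hγ, hle⟩ := exists_eptCost_le (D := D) hb hc hc0 hw₁m hw₂m hw₁ hw₂ hlam
    fun u v huv => EReal.coe_le_coe_iff.1 ((le_iSup₂_of_le (u, v) huv le_rfl).trans hD.le)
  exact (iInf₂_le γ hγ).trans hle
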